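/- Let $H$ be a (real or complex) Hilbert space with norm $\|\cdot\|$, and let $A : D(A)\subset H\to H$ be a densely defined, selfadjoint, positive definite linear operator with compact inverse. Let $T>0$, $u^0\in H$ and $f\in C([0,T];H)$. For a real function $\varphi$ bounded on the spectrum of $A$, write $\varphi(A)v=\sum_{\mu}\varphi(\mu)P_\mu v$, where $\mu$ runs through the eigenvalues of $A$ and $P_\mu$ is the orthogonal projection onto the eigenspace of $\mu$. Consider the three-stage Lobatto IIIC method, with coefficients $$\mathcal A=\begin{pmatrix}\frac16&-\frac13&\frac16\\[2pt] \frac16&\frac5{12}&-\frac1{12}\\[2pt] \frac16&\frac23&\frac16\end{pmatrix},\qquad b=\Big(\tfrac16,\tfrac23,\tfrac16\Big)^{\top},\qquad (c_1,c_2,c_3)=\Big(0,\tfrac12,1\Big),$$ and let $r(z)=1+z\,b^\top(I-z\mathcal A)^{-1}(1,1,1)^\top$ and $(p_1(z),p_2(z),p_3(z))=b^\top(I-z\mathcal A)^{-1}$. Let $J\ge 2$ and $N_c\ge 1$ be integers, $\Delta T=T/N_c$, $\Delta t=\Delta T/J$, $T_n=n\Delta T$, $t_n=n\Delta t$, and define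 the fine and coarse propagators $$\mathcal F(t,v)=r(-\Delta tA)v+\Delta t\sum_{i=1}^3p_i(-\Delta tA)f(t+c_i\Delta t),\qquad \mathcal G(t,v)=(I+\Delta TA)^{-1}\big(v+\Delta T f(t)\big).$$ Let $u^0,u^1,\dots,u^{N_cJ}$ be given by the initial value $u^0$ and $u^{n+1}=\mathcal F(t_n,u^n)$. Let $U_k^n$ ($k\ge0$, $0\le n\le N_c$) be the parareal iterates: $U_k^0=u^0$ for all $k$, $U_0^{n+1}=\mathcal G(T_n,U_0^n)$, and $$U_{k+1}^{n+1}=\mathcal G(T_n,U_{k+1}^n)+\widetilde U_k^{n+1}-\mathcal G(T_n,U_k^n),$$ where $\widetilde U_k^{n+1}=\widetilde U^{n,J}$ is obtained from $\widetilde U^{n,0}=U_k^n$ by the $J$ fine steps $\widetilde U^{n,j+1}=\mathcal F(T_n+j\Delta t,\widetilde U^{n,j})$, $0\le j<J$. Then $$r(-s)=\frac{24-6s}{s^3+6s^2+18s+24}\qquad\text{for all } s\ge0,$$ and the parareal iteration converges linearly with factor $0.31$ for every $J\ge2$: there is a constant $c$, which may depend on $A,T,u^0,f$ but not on $J$, $N_c$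 (hence not on $\Delta T$, $\Delta t$) or $k$, such that for all integers $J\ge2$, $N_c\ge1$ and $k\ge0$ $$\max_{1\le n\le N_c}\big\|U_k^n-u^{nJ}\big\|\le c\,\gamma^k\qquad\text{with }\gamma=0.31 .$$ -/

import Mathlib

open scoped Matrix InnerProductSpace

noncomputable section

namespace Parareal

section Operator

variable {𝕜 : Type*} [RCLike 𝕜] {H : Type*} [NormedAddCommGroup H] [InnerProductSpace 𝕜 H]
  [CompleteSpace H]

/-- A densely defined operator on the Hilbert space `H` (a partial linear map with domain
`A.domain`) which is selfadjoint, positive definite, and has a compact inverse. -/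
structure IsPosDefCompactInverse (A : H →ₗ.[𝕜] H) : Prop where
  dense_domain : Dense (A.domain : Set H)
  selfAdjoint : IsSelfAdjoint A
  pos : ∀ x : A.domain, x ≠ 0 → 0 < RCLike.re ⟪A x, (x : H)⟫_𝕜
  compact_inverse : ∃ K : H →L[𝕜] H, IsCompactOperator K ∧
    (∀ v : H, ∃ h : K v ∈ A.domain, A ⟨K v, h⟩ = v) ∧ (∀ x : A.domain, K (A x) = x)

/-- The space of all `x` in the domain of `A` with `A x = μ x`. -/
def eigenspace (A : H →ₗ.[𝕜] H) (μ : ℝ) : Submodule 𝕜 H where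
  carrier := {x | ∃ h : x ∈ A.domain, A ⟨x, h⟩ = (μ : 𝕜) • x}
  zero_mem' := ⟨A.domain.zero_mem, by
    rw [smul_zero]; exact A.map_zero⟩
  add_mem' := by
    rintro x y ⟨hx, ex⟩ ⟨hy, ey⟩
    refine ⟨A.domain.add_mem hx hy, ?_⟩
    rw [smul_add, ← ex, ← ey]
    exact A.map_add ⟨x, hx⟩ ⟨y, hy⟩
  smul_mem' := by
    rintro a x ⟨hx, ex⟩
    refine ⟨A.domain.smul_mem a hx, ?_⟩
    rw [smul_comm, ← ex]
    exact A.map_smul a ⟨x, hx⟩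

/-- The spectral calculus `φ(A) v = ∑_μ φ(μ) P_μ v` of a selfadjoint operator with compact
inverse: the sum is over the eigenvalues `μ` of `A` (for all other real `μ` the term vanishes),
`P_μ` is the orthogonal projection onto the eigenspace of `μ`. The series converges for every `v`
if `φ` is bounded on the set of eigenvalues. The eigenspaces of a selfadjoint operator are closed;
the topological closure is taken so that the projection makes sense for any `A`. -/
def specCalc (A : H →ₗ.[𝕜] H) (φ : ℝ → ℝ) (v : H) : H :=
  ∑' μ : ℝ, (φ μ : 𝕜) • (eigenspace A μ).topologicalClosure.starProjection v

end Operator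

/-- The Butcher tableau of an `m`-stage Runge--Kutta method. -/
structure ButcherTableau (m : ℕ) where
  /-- The matrix of the stage coefficients. -/
  a : Matrix (Fin m) (Fin m) ℝ
  /-- The weights. -/
  b : Fin m → ℝ
  /-- The nodes. -/
  c : Fin m → ℝ

/-- The stability function `r(z) = 1 + z bᵀ (I - z a)⁻¹ 𝟙`. -/
def ButcherTableau.r {m : ℕ} (B : ButcherTableau m) (z : ℝ) : ℝ :=
  1 + z * (B.b ⬝ᵥ ((1 - z • B.a)⁻¹ *ᵥ (fun _ => 1)))

/-- The weight functions `(p_1(z), …, p_m(z)) = bᵀ (I - z a)⁻¹`: one step of size `τ` of the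
Runge--Kutta method for `u' = -λ u + f` maps `u` to
`r(-τ λ) u + τ ∑ i, p_i(-τ λ) f(t + c_i τ)`. -/
def ButcherTableau.p {m : ℕ} (B : ButcherTableau m) (i : Fin m) (z : ℝ) : ℝ :=
  (B.b ᵥ* (1 - z • B.a)⁻¹) i

/-- The three-stage Lobatto IIIC method. -/
def lobattoIIIC3 : ButcherTableau 3 where
  a := !![1/6, -1/3, 1/6;
          1/6, 5/12, -1/12;
          1/6, 2/3, 1/6]
  b := ![1/6, 2/3, 1/6]
  c := ![0, 1/2, 1]

section Propagators

variable {𝕜 : Type*} [RCLike 𝕜] {H : Type*} [NormedAddCommGroup H] [InnerProductSpace 𝕜 H]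
  [CompleteSpace H]

/-- The fine propagator, one step of size `τ` from time `t` of the single step scheme:
`r(-τ A) v + τ ∑ i, p_i(-τ A) f(t + c_i τ)`. -/
def fineStep (A : H →ₗ.[𝕜] H) {m : ℕ} (B : ButcherTableau m) (f : ℝ → H) (t τ : ℝ) (v : H) : H :=
  specCalc A (fun μ => B.r (-(τ * μ))) v +
    (τ : 𝕜) • ∑ i : Fin m, specCalc A (fun μ => B.p i (-(τ * μ))) (f (t + B.c i * τ))

/-- The coarse propagator, one backward Euler step of size `τ` from time `t`:
`(I + τ A)⁻¹ (v + τ f(t))`. -/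
def coarseStep (A : H →ₗ.[𝕜] H) (f : ℝ → H) (t τ : ℝ) (v : H) : H :=
  specCalc A (fun μ => (1 + τ * μ)⁻¹) (v + (τ : 𝕜) • f t)

/-- `jSteps … t τ v j` is the result of `j` consecutive fine steps of size `τ`, starting with the
value `v` at time `t`. -/
def jSteps (A : H →ₗ.[𝕜] H) {m : ℕ} (B : ButcherTableau m) (f : ℝ → H) (t τ : ℝ) (v : H) : ℕ → H
  | 0 => v
  | j + 1 => fineStep A B f (t + j * τ) τ (jSteps A B f t τ v j)

/-- The solution `u^n` at time `n τ` of the time stepping scheme with step size `τ` and initial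
value `u0` at time `0`. -/
def timeStepping (A : H →ₗ.[𝕜] H) {m : ℕ} (B : ButcherTableau m) (f : ℝ → H) (u0 : H) (τ : ℝ)
    (n : ℕ) : H :=
  jSteps A B f 0 τ u0 n

/-- The initial guess `U_0^n` of the parareal iteration: `n` coarse steps of size `J τ`. -/
def pararealInit (A : H →ₗ.[𝕜] H) (f : ℝ → H) (u0 : H) (J : ℕ) (τ : ℝ) : ℕ → H
  | 0 => u0
  | n + 1 => coarseStep A f (n * (J * τ)) (J * τ) (pararealInit A f u0 J τ n)

/-- One parareal iteration: from the current iterate `n ↦ U n` to the next iterate `V`, given by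
`V 0 = u0` and, with coarse step size `J τ` and `T_n = n J τ`,
`V (n+1) = G(T_n, V n) + (J fine steps of size τ from U n, starting at T_n) - G(T_n, U n)`. -/
def pararealNext (A : H →ₗ.[𝕜] H) {m : ℕ} (B : ButcherTableau m) (f : ℝ → H) (u0 : H) (J : ℕ)
    (τ : ℝ) (U : ℕ → H) : ℕ → H
  | 0 => u0
  | n + 1 =>
      coarseStep A f (n * (J * τ)) (J * τ) (pararealNext A B f u0 J τ U n)
        + jSteps A B f (n * (J * τ)) τ (U n) J
        - coarseStep A f (n * (J * τ)) (J * τ) (U n)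

/-- The parareal iterates `U_k^n`, with fine step size `τ` and coarse step size `J τ`. -/
def parareal (A : H →ₗ.[𝕜] H) {m : ℕ} (B : ButcherTableau m) (f : ℝ → H) (u0 : H) (J : ℕ)
    (τ : ℝ) : ℕ → ℕ → H
  | 0 => pararealInit A f u0 J τ
  | k + 1 => pararealNext A B f u0 J τ (parareal A B f u0 J τ k)

end Propagators

end Parareal

end

open scoped Matrix InnerProductSpace

noncomputable section

namespace Parareal

/-! Projected onto an eigenspace of `A`, the source terms cancel in the error recursion, leaving
e_{k+1}^{n+1} = R e_{k+1}^n + (r^J - R) e_k^n with s = τμ and R = 1/(1 + Js)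
(`eigProj_parareal_succ_sub`). If |r^J - R| ≤ 0.31 (1 - R), the weights R and 1 - R combine
convexly, so induction on n shows that max_n |e_k^n| shrinks by 0.31 per iteration.

With x = Js the contraction bound reads |r^J (1 + x) - 1| ≤ 0.31 x (`abs_lobattoR_pow_sub_le`). The
upper half follows from |r| ≤ 1/(1 + s) and Bernoulli. The lower half compares r(-s) with exp(-1.015
s), which reduces it to a J-free inequality in x.

The modes are summed in ℓ². A single family M(μ) dominates the initial error of mode μ for all n at
once, and its ℓ² norm is bounded independently of the step sizes. -/

/-! ### Lower bounds for exp(-1.015 x) -/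

/-- The cubic Taylor polynomial of `exp` minus a quartic error term. -/
def expQuartic (w : ℝ) : ℝ := 1 + w + 1 / 2 * w ^ 2 + 1 / 6 * w ^ 3 - 5 / 96 * w ^ 4

theorem expQuartic_le_exp {w : ℝ} (hw : |w| ≤ 1) : expQuartic w ≤ Real.exp w := by
  have h := (abs_le.1 (Real.exp_bound hw (n := 4) (by norm_num))).1
  have h4 : |w| ^ 4 = w ^ 4 := by
    rw [← abs_pow]; exact abs_of_nonneg (by positivity)
  simp only [Finset.sum_range_succ, Finset.sum_range_zero, Nat.factorial, h4] at h
  norm_num at h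
  unfold expQuartic
  linarith

/-- This and the next three bounds are certified in Bernstein form: the difference of the two sides
is a nonnegative combination of the products (x - a)^i (b - x)^j with i + j = 5. The term h 0 5 is
absent here because equality holds at x = 0. -/
theorem quartic_bound_zero {x : ℝ} (h₁ : 0 ≤ x) (h₂ : x ≤ (1 / 2)) :
    1 - 31 / 100 * x ≤ (1 + x) * (1 * expQuartic (0 - 203 / 200 * x)) := by
  unfold expQuartic
  have h : ∀ i j : ℕ, 0 ≤ (x - 0) ^ i * ((1 / 2) - x) ^ j := fun i j =>
    mul_nonneg (pow_nonneg (by linarith) i) (pow_nonneg (by linarith) j)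
  linear_combination (118 / 25) * h 1 4
    + (148809 / 10000) * h 2 3
    + (212232373 / 12000000) * h 3 2
    + (140547747919 / 15360000000) * h 4 1
    + (16075095759 / 10240000000) * h 5 0

theorem quartic_bound_one {x : ℝ} (h₁ : (1 / 2) ≤ x) (h₂ : x ≤ (6 / 5)) :
    1 - 31 / 100 * x ≤ (1 + x) * ((1839 / 5000) * expQuartic (1 - 203 / 200 * x)) := by
  unfold expQuartic
  have h : ∀ i j : ℕ, 0 ≤ (x - (1 / 2)) ^ i * ((6 / 5) - x) ^ j := fun i j =>
    mul_nonneg (pow_nonneg (by linarith) i) (pow_nonneg (by linarith) j)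
  linear_combination (89481375681601 / 275365888000000) * h 0 5
    + (1175871099323601 / 688414720000000) * h 1 4
    + (318870702780369 / 107564800000000) * h 2 3
    + (1257123097742327 / 537824000000000) * h 3 2
    + (611973900600159 / 672280000000000) * h 4 1
    + (224980160845177 / 1680700000000000) * h 5 0

theorem quartic_bound_two {x : ℝ} (h₁ : (6 / 5) ≤ x) (h₂ : x ≤ (12 / 5)) :
    1 - 31 / 100 * x ≤ (1 + x) * ((1353 / 10000) * expQuartic (2 - 203 / 200 * x)) := by
  unfold expQuartic
  have h : ∀ i j : ℕ, 0 ≤ (x - (6 / 5)) ^ i * ((12 / 5) - x) ^ j := fun i j =>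
    mul_nonneg (pow_nonneg (by linarith) i) (pow_nonneg (by linarith) j)
  linear_combination (227394985210879 / 49766400000000000) * h 0 5
    + (227191761363649 / 9953280000000000) * h 1 4
    + (1469853605647 / 124416000000000) * h 2 3
    + (13832603019631 / 1244160000000000) * h 3 2
    + (25565527216861 / 622080000000000) * h 4 1
    + (49943626705213 / 3110400000000000) * h 5 0

theorem quartic_bound_three {x : ℝ} (h₁ : (12 / 5) ≤ x) (h₂ : x ≤ (100 / 31)) :
    1 - 31 / 100 * x ≤ (1 + x) * ((497 / 10000) * expQuartic (3 - 203 / 200 * x)) := by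
  unfold expQuartic
  have h : ∀ i j : ℕ, 0 ≤ (x - (12 / 5)) ^ i * ((100 / 31) - x) ^ j := fun i j =>
    mul_nonneg (pow_nonneg (by linarith) i) (pow_nonneg (by linarith) j)
  linear_combination (1407222690983870644187 / 13743895347200000000000) * h 0 5
    + (2044036465799705936091 / 2748779069440000000000) * h 1 4
    + (110533209834299929619 / 54975581388800000000) * h 2 3
    + (138932461003026293 / 52776558133248000) * h 3 2
    + (35492928060756913 / 21110623253299200) * h 4 1
    + (116933216641815 / 281474976710656) * h 5 0

theorem exp_neg_lower {e w : ℝ} (k x : ℝ) (he : 0 ≤ e) (hk : e ≤ Real.exp (-k))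
    (hw : w = k - 203 / 200 * x) (hw1 : |w| ≤ 1) :
    e * expQuartic w ≤ Real.exp (-(203 / 200 * x)) := by
  have : Real.exp (-(203 / 200 * x)) = Real.exp (-k) * Real.exp w := by
    rw [← Real.exp_add, hw]; congr 1; ring
  rw [this]
  calc e * expQuartic w ≤ e * Real.exp w :=
        mul_le_mul_of_nonneg_left (expQuartic_le_exp hw1) he
    _ ≤ _ := mul_le_mul_of_nonneg_right hk (Real.exp_pos w).le

/-- Taylor bounds are accurate only near 0, so the interval is cut into four pieces, with exp(-1.015
x) expanded about exponent -k for k = 0, 1, 2, 3. At 100/31 the left side vanishes. -/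
theorem one_sub_le_exp_neg {x : ℝ} (h₀ : 0 ≤ x) (h₁ : x ≤ 100 / 31) :
    1 - 31 / 100 * x ≤ (1 + x) * Real.exp (-(203 / 200 * x)) := by
  have e1 := Real.exp_neg_one_gt_d9
  have e2 : (1353 / 10000 : ℝ) ≤ Real.exp (-2) := by
    rw [show (-2 : ℝ) = -1 + -1 by norm_num, Real.exp_add]
    norm_num at e1 ⊢
    nlinarith
  have e3 : (497 / 10000 : ℝ) ≤ Real.exp (-3) := by
    rw [show (-3 : ℝ) = -2 + -1 by norm_num, Real.exp_add]
    norm_num at e1 ⊢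
    nlinarith
  have hx : 0 ≤ 1 + x := by linarith
  rcases le_total x (1 / 2) with h | h
  · refine (quartic_bound_zero h₀ h).trans (mul_le_mul_of_nonneg_left ?_ hx)
    exact exp_neg_lower 0 x (by norm_num) (by simp) rfl
      (abs_le.2 ⟨by linarith, by linarith⟩)
  rcases le_total x (6 / 5) with h' | h'
  · refine (quartic_bound_one h h').trans (mul_le_mul_of_nonneg_left ?_ hx)
    exact exp_neg_lower 1 x (by norm_num) (by norm_num at e1 ⊢; linarith) rfl
      (abs_le.2 ⟨by linarith, by linarith⟩)
  rcases le_total x (12 / 5) with h'' | h''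
  · refine (quartic_bound_two h' h'').trans (mul_le_mul_of_nonneg_left ?_ hx)
    exact exp_neg_lower 2 x (by norm_num) (by norm_num at e2 ⊢; linarith) rfl
      (abs_le.2 ⟨by linarith, by linarith⟩)
  · refine (quartic_bound_three h'' h₁).trans (mul_le_mul_of_nonneg_left ?_ hx)
    exact exp_neg_lower 3 x (by norm_num) (by norm_num at e3 ⊢; linarith) rfl
      (abs_le.2 ⟨by linarith, by linarith⟩)

/-! ### The stability function and the scalar contraction estimate -/

/-- The stability function of the three-stage Lobatto IIIC method at `-s`. -/
def lobattoR (s : ℝ) : ℝ := (24 - 6 * s) / (s ^ 3 + 6 * s ^ 2 + 18 * s + 24)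

/-- Both sides equal 24 at x = 0; dividing the difference by x leaves degree 7, which has
nonnegative Bernstein coefficients on [0, 50/31]. -/
theorem taylor_exp_mul_bound {x : ℝ} (h₁ : 0 ≤ x) (h₂ : x ≤ 50 / 31) :
    x ^ 3 + 6 * x ^ 2 + 18 * x + 24 ≤
      (24 - 6 * x) * ∑ i ∈ Finset.range 8, (203 / 200 * x) ^ i / (i.factorial : ℝ) := by
  simp only [Finset.sum_range_succ, Finset.sum_range_zero, Nat.factorial]
  push_cast
  have h : ∀ i j : ℕ, 0 ≤ (x - 0) ^ i * ((50 / 31) - x) ^ j := fun i j =>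
    mul_nonneg (pow_nonneg (by linarith) i) (pow_nonneg (by linarith) j)
  linear_combination x * ((247613526999 / 19531250000000) * h 0 7
    + (16286580050031 / 156250000000000) * h 1 6
    + (229751599286043 / 625000000000000) * h 2 5
    + (7205422441201161 / 10000000000000000) * h 3 4
    + (167042683853549743 / 200000000000000000) * h 4 3
    + (106452482986159429 / 192000000000000000) * h 5 2
    + (3488316853568542277 / 19200000000000000000) * h 6 1
    + (8519344244378799 / 512000000000000000) * h 7 0)

/-- The rate exceeds 1 because r(-s) drops below exp(-s); 1.015 is large enough for this comparison
and small enough for `one_sub_le_exp_neg`. -/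
theorem exp_neg_le_lobattoR {s : ℝ} (h₁ : 0 ≤ s) (h₂ : s ≤ 50 / 31) :
    Real.exp (-(203 / 200 * s)) ≤ lobattoR s := by
  unfold lobattoR
  rw [le_div_iff₀ (by positivity), Real.exp_neg, inv_mul_le_iff₀ (Real.exp_pos _),
    mul_comm (Real.exp _)]
  refine (taylor_exp_mul_bound h₁ h₂).trans (mul_le_mul_of_nonneg_left ?_ (by linarith))
  exact Real.sum_le_exp_of_nonneg (by positivity) 8

theorem abs_lobattoR_le {s : ℝ} (hs : 0 ≤ s) : |lobattoR s| ≤ 1 / (1 + s) := by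
  unfold lobattoR
  have hd : 0 < s ^ 3 + 6 * s ^ 2 + 18 * s + 24 := by positivity
  have h3 : 0 ≤ s ^ 3 := by positivity
  rw [abs_div, abs_of_pos hd, div_le_div_iff₀ hd (by positivity), ← abs_of_nonneg (show 0 ≤ 1 + s by positivity),
    ← abs_mul, abs_le]
  constructor <;> nlinarith [sq_nonneg s]

theorem abs_lobattoR_le_one {s : ℝ} (hs : 0 ≤ s) : |lobattoR s| ≤ 1 :=
  (abs_lobattoR_le hs).trans (by rw [div_le_one (by positivity)]; linarith)

theorem abs_pow_mul_le {s : ℝ} (hs : 0 ≤ s) (J : ℕ) : |lobattoR s ^ J * (1 + J * s)| ≤ 1 := by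
  have hp : 0 < (1 + s) ^ J := by positivity
  have h1 : 1 + J * s ≤ (1 + s) ^ J := one_add_mul_le_pow (by linarith) J
  rw [abs_mul, abs_pow, abs_of_nonneg (show 0 ≤ 1 + J * s by positivity)]
  calc |lobattoR s| ^ J * (1 + J * s) ≤ (1 / (1 + s)) ^ J * (1 + s) ^ J := by
        gcongr; exact abs_lobattoR_le hs
    _ = 1 := by rw [← mul_pow, one_div_mul_cancel (by positivity), one_pow]

theorem one_sub_le_lobattoR_pow {s : ℝ} (hs : 0 ≤ s) {J : ℕ} (hJ : 2 ≤ J) :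
    1 - 31 / 100 * (J * s) ≤ lobattoR s ^ J * (1 + J * s) := by
  have hJ' : (2 : ℝ) ≤ J := by exact_mod_cast hJ
  have hx : 0 ≤ J * s := by positivity
  rcases le_total (J * s) (100 / 31) with h | h
  -- Here J ≥ 2 halves the range of s.
  · have hs2 : s ≤ 50 / 31 := by nlinarith
    refine (one_sub_le_exp_neg hx h).trans ?_
    rw [mul_comm]
    refine mul_le_mul_of_nonneg_right ?_ (by positivity)
    rw [show -(203 / 200 * (J * s)) = J * (-(203 / 200 * s)) by ring, Real.exp_nat_mul]
    exact pow_le_pow_left₀ (Real.exp_pos _).le (exp_neg_le_lobattoR hs hs2) J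
  · rcases le_total s 4 with h4 | h4
    · have : 0 ≤ lobattoR s := div_nonneg (by linarith) (by positivity)
      have : 0 ≤ lobattoR s ^ J * (1 + J * s) := by positivity
      linarith
    -- For s > 4, r may be negative, but x ≥ 8 makes the left side less than -1.
    · have hb : |lobattoR s ^ J * (1 + J * s)| ≤ 1 := abs_pow_mul_le hs J
      have := (abs_le.1 hb).1
      nlinarith

/-- The contraction factor of one mode. -/
theorem abs_lobattoR_pow_sub_le {s : ℝ} (hs : 0 ≤ s) {J : ℕ} (hJ : 2 ≤ J) :
    |lobattoR s ^ J - (1 + J * s)⁻¹| ≤ 31 / 100 * (1 - (1 + J * s)⁻¹) := by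
  have hx : 0 < 1 + J * s := by positivity
  have key : |lobattoR s ^ J * (1 + J * s) - 1| ≤ 31 / 100 * (J * s) := by
    have h1 := one_sub_le_lobattoR_pow hs hJ
    have h2 := (abs_le.1 (abs_pow_mul_le hs J)).2
    have : 0 ≤ J * s := by positivity
    rw [abs_le]; constructor <;> linarith
  have e1 : lobattoR s ^ J - (1 + J * s)⁻¹ = (lobattoR s ^ J * (1 + J * s) - 1) / (1 + J * s) := by
    field_simp
  have e2 : 31 / 100 * (1 - (1 + J * s)⁻¹) = 31 / 100 * (J * s) / (1 + J * s) := by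
    field_simp; ring
  rw [e1, e2, abs_div, abs_of_pos hx]
  gcongr

/-! ### Closed forms and bounds for the weights -/

/-- The weights `p_i(-s)` of the three-stage Lobatto IIIC method. -/
def lobattoP (s : ℝ) : Fin 3 → ℝ :=
  ![(4 - s) / (s ^ 3 + 6 * s ^ 2 + 18 * s + 24), (16 + 4 * s) / (s ^ 3 + 6 * s ^ 2 + 18 * s + 24),
    (4 + 3 * s + s ^ 2) / (s ^ 3 + 6 * s ^ 2 + 18 * s + 24)]

/-- The inverse need not be computed: the proposed row vector times the matrix gives b, and the
determinant is nonzero. -/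
theorem lobatto_vecMul_inv {s : ℝ} (hs : 0 ≤ s) :
    lobattoIIIC3.b ᵥ* (1 - (-s) • lobattoIIIC3.a)⁻¹ = lobattoP s := by
  have hd : s ^ 3 + 6 * s ^ 2 + 18 * s + 24 ≠ 0 := by positivity
  have hdet : (1 - (-s) • lobattoIIIC3.a).det = (s ^ 3 + 6 * s ^ 2 + 18 * s + 24) / 24 := by
    simp [Matrix.det_fin_three, lobattoIIIC3]
    ring
  have hb : lobattoIIIC3.b = lobattoP s ᵥ* (1 - (-s) • lobattoIIIC3.a) := by
    ext i
    fin_cases i <;>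
      simp [Matrix.vecMul, dotProduct, Fin.sum_univ_three, lobattoIIIC3, lobattoP] <;>
      field_simp <;> ring
  rw [hb, Matrix.vecMul_vecMul, Matrix.mul_nonsing_inv _ (by rw [hdet]; exact (div_ne_zero hd (by norm_num)).isUnit),
    Matrix.vecMul_one]

theorem lobatto_p {s : ℝ} (hs : 0 ≤ s) (i : Fin 3) : lobattoIIIC3.p i (-s) = lobattoP s i := by
  rw [ButcherTableau.p, lobatto_vecMul_inv hs]

theorem lobatto_r {s : ℝ} (hs : 0 ≤ s) : lobattoIIIC3.r (-s) = lobattoR s := by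
  have hd : s ^ 3 + 6 * s ^ 2 + 18 * s + 24 ≠ 0 := by positivity
  rw [ButcherTableau.r, Matrix.dotProduct_mulVec, lobatto_vecMul_inv hs]
  simp [dotProduct, Fin.sum_univ_three, lobattoP, lobattoR]
  field_simp
  ring

theorem abs_lobatto_p_le {s : ℝ} (hs : 0 ≤ s) (i : Fin 3) : |lobattoIIIC3.p i (-s)| ≤ 1 := by
  have hd : 0 < s ^ 3 + 6 * s ^ 2 + 18 * s + 24 := by positivity
  have h3 : 0 ≤ s ^ 3 := by positivity
  have h2 : 0 ≤ s ^ 2 := by positivity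
  rw [lobatto_p hs]
  fin_cases i <;> simp only [lobattoP] <;> simp [abs_div, abs_of_pos hd] <;>
    rw [div_le_one hd, abs_le] <;> constructor <;> nlinarith

/-! ### Spectral decomposition of `A` -/

section Spectral

variable {𝕜 : Type*} [RCLike 𝕜] {H : Type*} [NormedAddCommGroup H] [InnerProductSpace 𝕜 H]
  [CompleteSpace H]

/-- The orthogonal projection onto the (closed) eigenspace of `μ`. -/
def eigProj (A : H →ₗ.[𝕜] H) (μ : ℝ) : H →L[𝕜] H :=
  (eigenspace A μ).topologicalClosure.starProjection

namespace IsPosDefCompactInverse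

variable {A : H →ₗ.[𝕜] H} (hA : IsPosDefCompactInverse A)
include hA

theorem inner_apply_left (x y : A.domain) : ⟪A x, (y : H)⟫_𝕜 = ⟪(x : H), A y⟫_𝕜 := by
  have h := LinearPMap.adjoint_isFormalAdjoint (T := A) hA.dense_domain
  rw [LinearPMap.isSelfAdjoint_def.1 hA.selfAdjoint] at h
  exact h x y

theorem eigenspace_eq_bot {μ : ℝ} (hμ : μ ≤ 0) : eigenspace A μ = ⊥ := by
  rw [Submodule.eq_bot_iff]
  rintro x ⟨hx, ex⟩
  by_contra h0
  have h := hA.pos ⟨x, hx⟩ (fun h => h0 (congrArg Subtype.val h))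
  rw [ex, inner_smul_left, RCLike.conj_ofReal, RCLike.re_ofReal_mul, inner_self_eq_norm_sq] at h
  nlinarith [sq_nonneg ‖x‖]

theorem eigProj_eq_zero {μ : ℝ} (hμ : μ ≤ 0) (v : H) : eigProj A μ v = 0 := by
  have h := Submodule.starProjection_apply_mem (eigenspace A μ).topologicalClosure v
  have hb : (eigenspace A μ).topologicalClosure ≤ ⊥ :=
    Submodule.topologicalClosure_minimal _ (hA.eigenspace_eq_bot hμ).le (by simp)
  exact (Submodule.mem_bot 𝕜).1 (hb h)

theorem eigenspace_isOrtho {μ ν : ℝ} (h : μ ≠ ν) : eigenspace A μ ⟂ eigenspace A ν := by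
  rw [Submodule.isOrtho_iff_inner_eq]
  rintro x ⟨hx, ex⟩ y ⟨hy, ey⟩
  have e := hA.inner_apply_left ⟨x, hx⟩ ⟨y, hy⟩
  rw [ex, ey, inner_smul_left, inner_smul_right, RCLike.conj_ofReal] at e
  have h' : ((μ : 𝕜) - (ν : 𝕜)) * ⟪x, y⟫_𝕜 = 0 := by rw [sub_mul, e, sub_self]
  refine (mul_eq_zero.1 h').resolve_left ?_
  exact sub_ne_zero.2 (by exact_mod_cast h)

theorem closure_eigenspace_isOrtho {μ ν : ℝ} (h : μ ≠ ν) :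
    (eigenspace A μ).topologicalClosure ⟂ (eigenspace A ν).topologicalClosure := by
  have h1 : (eigenspace A μ).topologicalClosure ≤ (eigenspace A ν)ᗮ :=
    Submodule.topologicalClosure_minimal _ (hA.eigenspace_isOrtho h) (Submodule.isClosed_orthogonal _)
  have h2 : (eigenspace A ν).topologicalClosure ≤ ((eigenspace A μ).topologicalClosure)ᗮ :=
    Submodule.topologicalClosure_minimal _
      (Submodule.IsOrtho.symm (U := (eigenspace A μ).topologicalClosure) h1)
      (Submodule.isClosed_orthogonal _)
  exact Submodule.IsOrtho.symm h2

theorem orthogonalFamily : OrthogonalFamily 𝕜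
    (fun μ : ℝ => (eigenspace A μ).topologicalClosure)
    fun μ => (eigenspace A μ).topologicalClosure.subtypeₗᵢ := fun _ _ h x y =>
  (Submodule.isOrtho_iff_inner_eq.1 (hA.closure_eigenspace_isOrtho h)) x x.2 y y.2

/-- The eigenvectors of the compact symmetric inverse K are total. Its eigenvalues are real and
nonzero, since K is injective, and an eigenvector for μ is one of `A` for 1/μ. -/
theorem eq_zero_of_forall_eigProj {v : H} (hv : ∀ μ : ℝ, eigProj A μ v = 0) : v = 0 := by
  obtain ⟨K, hK, hAK, hKA⟩ := hA.compact_inverse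
  have hsymm : (K : H →ₗ[𝕜] H).IsSymmetric := by
    intro x y
    obtain ⟨hx, ex⟩ := hAK x
    obtain ⟨hy, ey⟩ := hAK y
    have e := hA.inner_apply_left ⟨K x, hx⟩ ⟨K y, hy⟩
    rw [ex, ey] at e
    exact e.symm
  have htot := ContinuousLinearMap.orthogonalComplement_iSup_eigenspaces_eq_bot hK hsymm
  rw [← Submodule.mem_bot 𝕜, ← htot, ← Submodule.iInf_orthogonal, Submodule.mem_iInf]
  intro μ
  rw [Submodule.mem_orthogonal]
  intro x hx
  rw [Module.End.mem_eigenspace_iff] at hx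
  change K x = μ • x at hx
  by_cases hx0 : x = 0
  · rw [hx0, inner_zero_left]
  obtain ⟨hdom, hAx⟩ := hAK x
  have hμ : μ ≠ 0 := by
    rintro rfl
    have h0 : (⟨K x, hdom⟩ : A.domain) = 0 := Subtype.ext (by simpa using hx)
    rw [h0, A.map_zero] at hAx
    exact hx0 hAx.symm
  have hreal : (RCLike.re μ : 𝕜) = μ := by
    have hev : Module.End.HasEigenvalue (K : H →ₗ[𝕜] H) μ :=
      Module.End.hasEigenvalue_of_hasEigenvector
        ⟨Module.End.mem_eigenspace_iff.2 hx, hx0⟩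
    exact RCLike.conj_eq_iff_re.1 (hsymm.conj_eigenvalue_eq_self hev)
  have hxe : x ∈ eigenspace A (RCLike.re μ)⁻¹ := by
    have e1 : x = μ⁻¹ • K x := by rw [hx, smul_smul, inv_mul_cancel₀ hμ, one_smul]
    have hxd : x ∈ A.domain := e1 ▸ A.domain.smul_mem _ hdom
    refine ⟨hxd, ?_⟩
    have e2 : (⟨x, hxd⟩ : A.domain) = μ⁻¹ • ⟨K x, hdom⟩ := Subtype.ext e1
    rw [e2, A.map_smul, hAx, RCLike.ofReal_inv, hreal]
  exact (Submodule.starProjection_apply_eq_zero_iff _).1 (hv _) x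
    (Submodule.le_topologicalClosure _ hxe)

theorem eigProj_eigProj (μ ν : ℝ) (v : H) :
    eigProj A μ (eigProj A ν v) = if ν = μ then eigProj A μ v else 0 := by
  split_ifs with h
  · subst h
    exact Submodule.starProjection_eq_self_iff.2 (Submodule.starProjection_apply_mem _ _)
  · have := (hA.closure_eigenspace_isOrtho (Ne.symm h)).starProjection_comp_starProjection
    exact congrArg (fun T : H →L[𝕜] H => T v) this

theorem norm_sq_sum_eigProj (φ : ℝ → ℝ) (v : H) (s : Finset ℝ) :
    ‖∑ μ ∈ s, (φ μ : 𝕜) • eigProj A μ v‖ ^ 2 = ∑ μ ∈ s, (φ μ) ^ 2 * ‖eigProj A μ v‖ ^ 2 := by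
  have h := hA.orthogonalFamily.norm_sum (fun μ => (φ μ : 𝕜) • ⟨eigProj A μ v,
    Submodule.starProjection_apply_mem _ _⟩) s
  simpa [norm_smul, mul_pow] using h

/-- Bessel's inequality. -/
theorem sum_norm_sq_eigProj_le (v : H) (s : Finset ℝ) :
    ∑ μ ∈ s, ‖eigProj A μ v‖ ^ 2 ≤ ‖v‖ ^ 2 := by
  have h1 := hA.norm_sq_sum_eigProj (fun _ => 1) v s
  simp only [RCLike.ofReal_one, one_smul, one_pow, one_mul] at h1
  have h2 : RCLike.re ⟪∑ μ ∈ s, eigProj A μ v, v⟫_𝕜 = ∑ μ ∈ s, ‖eigProj A μ v‖ ^ 2 := by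
    rw [sum_inner, map_sum]
    exact Finset.sum_congr rfl fun μ _ => Submodule.re_inner_starProjection_eq_normSq _ v
  have h3 := re_inner_le_norm (𝕜 := 𝕜) (∑ μ ∈ s, eigProj A μ v) v
  rw [h2, ← h1] at h3
  rw [← h1]
  nlinarith [norm_nonneg (∑ μ ∈ s, eigProj A μ v), norm_nonneg v,
    sq_nonneg (‖∑ μ ∈ s, eigProj A μ v‖ - ‖v‖)]

theorem summable_smul_eigProj {φ : ℝ → ℝ} {C : ℝ} (hφ : ∀ μ, 0 < μ → |φ μ| ≤ C) (v : H) :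
    Summable fun μ => (φ μ : 𝕜) • eigProj A μ v := by
  have h := (hA.orthogonalFamily.summable_iff_norm_sq_summable
    (fun μ => (φ μ : 𝕜) • ⟨eigProj A μ v, Submodule.starProjection_apply_mem _ _⟩)).2 ?_
  · simpa using h
  refine summable_of_sum_le (c := C ^ 2 * ‖v‖ ^ 2) (fun μ => sq_nonneg _) fun s => ?_
  calc _ ≤ ∑ μ ∈ s, C ^ 2 * ‖eigProj A μ v‖ ^ 2 := by
        refine Finset.sum_le_sum fun μ _ => ?_
        rcases le_or_gt μ 0 with hμ | hμ
        · simp [hA.eigProj_eq_zero hμ]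
        · rw [norm_smul, mul_pow, RCLike.norm_ofReal]
          exact mul_le_mul_of_nonneg_right (pow_le_pow_left₀ (abs_nonneg _) (hφ μ hμ) 2)
            (sq_nonneg _)
    _ ≤ _ := by
        rw [← Finset.mul_sum]
        exact mul_le_mul_of_nonneg_left (hA.sum_norm_sq_eigProj_le v s) (sq_nonneg _)

theorem eigProj_specCalc {φ : ℝ → ℝ} {C : ℝ} (hφ : ∀ μ, 0 < μ → |φ μ| ≤ C) (v : H) (μ : ℝ) :
    eigProj A μ (specCalc A φ v) = (φ μ : 𝕜) • eigProj A μ v := by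
  have h := (eigProj A μ).map_tsum (hA.summable_smul_eigProj hφ v)
  change eigProj A μ (∑' ν, (φ ν : 𝕜) • eigProj A ν v) = _
  rw [h, tsum_eq_single μ]
  · rw [map_smul, hA.eigProj_eigProj, if_pos rfl]
  · intro ν hν
    rw [map_smul, hA.eigProj_eigProj, if_neg hν, smul_zero]

/-- By completeness v is the sum of its projections, so the norms of finite partial sums converge to
‖v‖. -/
theorem norm_le_of_sum_eigProj_le {v : H} {C : ℝ} (hC : 0 ≤ C)
    (h : ∀ s : Finset ℝ, ∑ μ ∈ s, ‖eigProj A μ v‖ ^ 2 ≤ C ^ 2) : ‖v‖ ≤ C := by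
  have hb : ∀ μ : ℝ, 0 < μ → |(1 : ℝ)| ≤ 1 := fun _ _ => by simp
  have hs := hA.summable_smul_eigProj (φ := fun _ => 1) hb v
  have hv : v = ∑' μ : ℝ, (((1 : ℝ)) : 𝕜) • eigProj A μ v := by
    rw [← sub_eq_zero]
    refine hA.eq_zero_of_forall_eigProj fun μ => ?_
    have e := hA.eigProj_specCalc (φ := fun _ => 1) hb v μ
    rw [map_sub, sub_eq_zero]
    exact (e.trans (by simp)).symm
  have ht : Filter.Tendsto (fun s : Finset ℝ => ‖∑ μ ∈ s, ((1 : ℝ) : 𝕜) • eigProj A μ v‖)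
      Filter.atTop (nhds ‖v‖) := by
    conv => rhs; rw [hv]
    exact hs.hasSum.norm
  refine le_of_tendsto' ht fun s => ?_
  refine le_of_sq_le_sq ?_ hC
  have e := hA.norm_sq_sum_eigProj (fun _ => 1) v s
  simp only [one_pow, one_mul] at e
  rw [e]
  exact h s

end IsPosDefCompactInverse

end Spectral

/-! ### Minkowski's inequality for families of mode bounds -/

/-- The family `m` of real numbers has `ℓ²` norm at most `C`. -/
def L2NormLe (m : ℝ → ℝ) (C : ℝ) : Prop :=
  0 ≤ C ∧ ∀ s : Finset ℝ, ∑ μ ∈ s, m μ ^ 2 ≤ C ^ 2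

theorem L2NormLe.add {m m' : ℝ → ℝ} {C C' : ℝ} (h : L2NormLe m C) (h' : L2NormLe m' C') :
    L2NormLe (fun μ => m μ + m' μ) (C + C') := by
  refine ⟨add_nonneg h.1 h'.1, fun s => ?_⟩
  have h1 := Finset.sum_mul_sq_le_sq_mul_sq s m m'
  have h2 : (∑ μ ∈ s, m μ * m' μ) ^ 2 ≤ (C * C') ^ 2 := by
    rw [mul_pow]
    exact h1.trans (mul_le_mul (h.2 s) (h'.2 s) (Finset.sum_nonneg fun _ _ => sq_nonneg _)
      (sq_nonneg _))
  have h3 := abs_le_of_sq_le_sq h2 (mul_nonneg h.1 h'.1)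
  have h4 : ∑ μ ∈ s, (m μ + m' μ) ^ 2
      = ∑ μ ∈ s, m μ ^ 2 + 2 * ∑ μ ∈ s, m μ * m' μ + ∑ μ ∈ s, m' μ ^ 2 := by
    rw [Finset.mul_sum, ← Finset.sum_add_distrib, ← Finset.sum_add_distrib]
    exact Finset.sum_congr rfl fun _ _ => by ring
  rw [h4]
  linarith [h.2 s, h'.2 s, le_of_abs_le h3]

theorem L2NormLe.const_mul {m : ℝ → ℝ} {C a : ℝ} (ha : 0 ≤ a) (h : L2NormLe m C) :
    L2NormLe (fun μ => a * m μ) (a * C) := by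
  refine ⟨mul_nonneg ha h.1, fun s => ?_⟩
  simp only [mul_pow]
  rw [← Finset.mul_sum]
  exact mul_le_mul_of_nonneg_left (h.2 s) (sq_nonneg a)

theorem L2NormLe.sum {ι : Type*} (t : Finset ι) {m : ι → ℝ → ℝ} {C : ℝ}
    (h : ∀ i ∈ t, L2NormLe (m i) C) :
    L2NormLe (fun μ => ∑ i ∈ t, m i μ) (t.card * C) := by
  classical
  induction t using Finset.induction_on with
  | empty => simp [L2NormLe]
  | insert i t hi ih =>
    have h' := (h i (Finset.mem_insert_self i t)).add
      (ih fun j hj => h j (Finset.mem_insert_of_mem hj))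
    simp only [Finset.sum_insert hi, Finset.card_insert_of_notMem hi]
    convert h' using 1
    push_cast
    ring

/-! ### The parareal error, mode by mode -/

section Modes

variable {𝕜 : Type*} [RCLike 𝕜] {H : Type*} [NormedAddCommGroup H] [InnerProductSpace 𝕜 H]
  [CompleteSpace H]

theorem jSteps_add (A : H →ₗ.[𝕜] H) {m : ℕ} (B : ButcherTableau m) (f : ℝ → H) (t τ : ℝ) (v : H)
    (a b : ℕ) :
    jSteps A B f t τ v (a + b) = jSteps A B f (t + a * τ) τ (jSteps A B f t τ v a) b := by
  induction b with
  | zero => rfl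
  | succ b ih =>
    rw [← add_assoc, jSteps, jSteps, ih]
    congr 1
    push_cast
    ring

namespace IsPosDefCompactInverse

variable {A : H →ₗ.[𝕜] H} (hA : IsPosDefCompactInverse A) (f : ℝ → H)
include hA

theorem l2NormLe_eigProj {v : H} {C : ℝ} (hv : ‖v‖ ≤ C) :
    L2NormLe (fun μ => ‖eigProj A μ v‖) C :=
  ⟨(norm_nonneg v).trans hv, fun s => (hA.sum_norm_sq_eigProj_le v s).trans
    (pow_le_pow_left₀ (norm_nonneg v) hv 2)⟩

theorem eigProj_coarseStep {τ : ℝ} (hτ : 0 ≤ τ) (t : ℝ) (v : H) (μ : ℝ) :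
    eigProj A μ (coarseStep A f t τ v)
      = (((1 + τ * μ)⁻¹ : ℝ) : 𝕜) • (eigProj A μ v + (τ : 𝕜) • eigProj A μ (f t)) := by
  have hb : ∀ ν : ℝ, 0 < ν → |(1 + τ * ν)⁻¹| ≤ 1 := fun ν hν => by
    have : 0 ≤ τ * ν := by positivity
    rw [abs_of_nonneg (by positivity)]
    exact inv_le_one_of_one_le₀ (by linarith)
  rw [coarseStep, hA.eigProj_specCalc hb, map_add, map_smul]

theorem eigProj_fineStep {τ : ℝ} (hτ : 0 ≤ τ) (t : ℝ) (v : H) (μ : ℝ) :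
    eigProj A μ (fineStep A lobattoIIIC3 f t τ v)
      = ((lobattoIIIC3.r (-(τ * μ)) : ℝ) : 𝕜) • eigProj A μ v
        + (τ : 𝕜) • ∑ i, ((lobattoIIIC3.p i (-(τ * μ)) : ℝ) : 𝕜)
          • eigProj A μ (f (t + lobattoIIIC3.c i * τ)) := by
  have hr : ∀ ν : ℝ, 0 < ν → |lobattoIIIC3.r (-(τ * ν))| ≤ 1 := fun ν hν => by
    rw [lobatto_r (by positivity)]
    exact abs_lobattoR_le_one (by positivity)
  have hp : ∀ i, ∀ ν : ℝ, 0 < ν → |lobattoIIIC3.p i (-(τ * ν))| ≤ 1 := fun i ν hν =>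
    abs_lobatto_p_le (by positivity) i
  rw [fineStep, map_add, map_smul, map_sum, hA.eigProj_specCalc hr]
  congr 2
  exact Finset.sum_congr rfl fun i _ => hA.eigProj_specCalc (hp i) _ μ

theorem eigProj_jSteps_sub {τ : ℝ} (hτ : 0 ≤ τ) (t : ℝ) (v w : H) (μ : ℝ) (j : ℕ) :
    eigProj A μ (jSteps A lobattoIIIC3 f t τ v j) - eigProj A μ (jSteps A lobattoIIIC3 f t τ w j)
      = ((lobattoIIIC3.r (-(τ * μ)) ^ j : ℝ) : 𝕜) • (eigProj A μ v - eigProj A μ w) := by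
  induction j with
  | zero => simp [jSteps]
  | succ j ih =>
    rw [jSteps, jSteps, hA.eigProj_fineStep f hτ, hA.eigProj_fineStep f hτ, add_sub_add_right_eq_sub,
      ← smul_sub, ih, smul_smul, pow_succ']
    push_cast
    rfl

theorem norm_eigProj_jSteps_le {τ : ℝ} (hτ : 0 ≤ τ) (t : ℝ) (v : H) {μ : ℝ} (hμ : 0 < μ) (j : ℕ) :
    ‖eigProj A μ (jSteps A lobattoIIIC3 f t τ v j)‖ ≤ ‖eigProj A μ v‖
      + τ * ∑ l ∈ Finset.range j, ∑ i, ‖eigProj A μ (f (t + l * τ + lobattoIIIC3.c i * τ))‖ := by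
  induction j with
  | zero => simp [jSteps]
  | succ j ih =>
    rw [jSteps, hA.eigProj_fineStep f hτ, Finset.sum_range_succ, mul_add, ← add_assoc]
    refine (norm_add_le _ _).trans (add_le_add ?_ ?_)
    · rw [norm_smul, RCLike.norm_ofReal, lobatto_r (by positivity)]
      exact (mul_le_of_le_one_left (norm_nonneg _) (abs_lobattoR_le_one (by positivity))).trans ih
    · rw [norm_smul, RCLike.norm_ofReal, abs_of_nonneg hτ]
      refine mul_le_mul_of_nonneg_left ((norm_sum_le _ _).trans ?_) hτ
      refine Finset.sum_le_sum fun i _ => ?_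
      rw [norm_smul, RCLike.norm_ofReal]
      exact mul_le_of_le_one_left (norm_nonneg _) (abs_lobatto_p_le (by positivity) i)

theorem norm_eigProj_pararealInit_le {τ : ℝ} (hτ : 0 ≤ τ) (u0 : H) (J : ℕ) {μ : ℝ} (hμ : 0 < μ)
    (n : ℕ) :
    ‖eigProj A μ (pararealInit A f u0 J τ n)‖ ≤ ‖eigProj A μ u0‖
      + J * τ * ∑ l ∈ Finset.range n, ‖eigProj A μ (f (l * (J * τ)))‖ := by
  induction n with
  | zero => simp [pararealInit]
  | succ n ih =>
    have hJ : 0 ≤ J * τ := by positivity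
    have hJμ : 0 ≤ J * τ * μ := by positivity
    rw [pararealInit, hA.eigProj_coarseStep f hJ, norm_smul, RCLike.norm_ofReal,
      abs_of_nonneg (by positivity), Finset.sum_range_succ, mul_add, ← add_assoc]
    refine (mul_le_of_le_one_left (norm_nonneg _) (inv_le_one_of_one_le₀ (by linarith))).trans ?_
    refine (norm_add_le _ _).trans (add_le_add ih ?_)
    rw [norm_smul, RCLike.norm_ofReal, abs_of_nonneg hJ]

/-- The fine solution is restarted at T_n. Two fine runs with the same source differ by r^J times
the difference of their starting values, and the coarse sources cancel. -/
theorem eigProj_parareal_succ_sub {τ : ℝ} (hτ : 0 ≤ τ) (u0 : H) (J k n : ℕ) (μ : ℝ) :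
    eigProj A μ (parareal A lobattoIIIC3 f u0 J τ (k + 1) (n + 1)
        - timeStepping A lobattoIIIC3 f u0 τ ((n + 1) * J))
      = (((1 + J * τ * μ)⁻¹ : ℝ) : 𝕜) • eigProj A μ (parareal A lobattoIIIC3 f u0 J τ (k + 1) n
          - timeStepping A lobattoIIIC3 f u0 τ (n * J))
        + ((lobattoIIIC3.r (-(τ * μ)) ^ J - (1 + J * τ * μ)⁻¹ : ℝ) : 𝕜)
          • eigProj A μ (parareal A lobattoIIIC3 f u0 J τ k n
            - timeStepping A lobattoIIIC3 f u0 τ (n * J)) := by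
  have hJ : 0 ≤ J * τ := by positivity
  have ht : timeStepping A lobattoIIIC3 f u0 τ ((n + 1) * J) = jSteps A lobattoIIIC3 f
      (n * (J * τ)) τ (timeStepping A lobattoIIIC3 f u0 τ (n * J)) J := by
    rw [timeStepping, add_mul, one_mul, jSteps_add, timeStepping]
    congr 1
    push_cast
    ring
  have hj := hA.eigProj_jSteps_sub f hτ (n * (J * τ)) (parareal A lobattoIIIC3 f u0 J τ k n)
    (timeStepping A lobattoIIIC3 f u0 τ (n * J)) μ J
  rw [sub_eq_iff_eq_add] at hj
  rw [ht, parareal, pararealNext]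
  simp only [map_sub, map_add, hA.eigProj_coarseStep f hJ, hj]
  module

/-- Linear convergence of each mode of the parareal error. -/
theorem norm_eigProj_parareal_sub_le {τ : ℝ} (hτ : 0 ≤ τ) (u0 : H) {J : ℕ} (hJ : 2 ≤ J) {N : ℕ}
    {μ M : ℝ} (hμ : 0 < μ) (h₀ : ∀ n ≤ N, ‖eigProj A μ (parareal A lobattoIIIC3 f u0 J τ 0 n
      - timeStepping A lobattoIIIC3 f u0 τ (n * J))‖ ≤ M) (k : ℕ) :
    ∀ n ≤ N, ‖eigProj A μ (parareal A lobattoIIIC3 f u0 J τ k n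
      - timeStepping A lobattoIIIC3 f u0 τ (n * J))‖ ≤ (31 / 100) ^ k * M := by
  have hM : 0 ≤ M := (norm_nonneg _).trans (h₀ 0 (Nat.zero_le _))
  induction k with
  | zero => simpa using h₀
  | succ k ihk =>
    intro n
    induction n with
    | zero =>
      intro _
      rw [zero_mul, timeStepping, jSteps, parareal, pararealNext, sub_self, map_zero, norm_zero]
      positivity
    | succ n ihn =>
      intro hn
      have hR : 0 ≤ (1 + J * τ * μ)⁻¹ := by positivity
      have hg := abs_lobattoR_pow_sub_le (s := τ * μ) (by positivity) hJ
      rw [← mul_assoc (J : ℝ)] at hg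
      rw [hA.eigProj_parareal_succ_sub f hτ]
      refine (norm_add_le _ _).trans ?_
      rw [norm_smul, norm_smul, RCLike.norm_ofReal, RCLike.norm_ofReal, abs_of_nonneg hR,
        lobatto_r (by positivity)]
      have hk := ihk n (by omega)
      -- The two terms add up to (R + (1 - R)) 0.31^(k+1) M.
      calc _ ≤ (1 + J * τ * μ)⁻¹ * ((31 / 100) ^ (k + 1) * M)
            + 31 / 100 * (1 - (1 + J * τ * μ)⁻¹) * ((31 / 100) ^ k * M) :=
          add_le_add (mul_le_mul_of_nonneg_left (ihn (by omega)) hR)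
            (mul_le_mul hg hk (norm_nonneg _) ((abs_nonneg _).trans hg))
        _ = _ := by ring

end IsPosDefCompactInverse

/-- Linear convergence of the parareal iteration, uniformly in the step sizes. -/
theorem norm_parareal_sub_le {A : H →ₗ.[𝕜] H} (hA : IsPosDefCompactInverse A)
    {T : ℝ} (hT : 0 < T) (u0 : H) {f : ℝ → H} {V : ℝ} (hV : ∀ t ∈ Set.Icc 0 T, ‖f t‖ ≤ V)
    {J N : ℕ} (hJ : 2 ≤ J) (hN : 1 ≤ N) {τ : ℝ} (hτ : τ = T / (N * J)) (k : ℕ) {n : ℕ}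
    (hn : n ≤ N) :
    ‖parareal A lobattoIIIC3 f u0 J τ k n - timeStepping A lobattoIIIC3 f u0 τ (n * J)‖
      ≤ (31 / 100) ^ k * (2 * ‖u0‖ + 4 * T * V) := by
  have hJ0 : (0 : ℝ) < J := by exact_mod_cast (by omega : 0 < J)
  have hN0 : (0 : ℝ) < N := by exact_mod_cast hN
  have hτ0 : 0 ≤ τ := by rw [hτ]; positivity
  have hT' : N * (J * τ) = T := by rw [hτ]; field_simp
  -- The coarse part contributes ‖u0‖ + TV to the ℓ² norm. The fine part contributes ‖u0‖ + 3TV, as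
  -- each of the three weights is at most 1 in absolute value. Extending the sums to the final time
  -- makes M independent of n.
  let M : ℝ → ℝ := fun μ => (‖eigProj A μ u0‖
      + J * τ * ∑ l ∈ Finset.range N, ‖eigProj A μ (f (l * (J * τ)))‖)
    + (‖eigProj A μ u0‖ + τ * ∑ l ∈ Finset.range (N * J), ∑ i,
      ‖eigProj A μ (f (0 + l * τ + lobattoIIIC3.c i * τ))‖)
  have hM : L2NormLe M (2 * ‖u0‖ + 4 * T * V) := by
    have h0 := hA.l2NormLe_eigProj (le_refl ‖u0‖)
    have h1 : L2NormLe (fun μ => ∑ l ∈ Finset.range N, ‖eigProj A μ (f (l * (J * τ)))‖)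
        ((Finset.range N).card * V) := by
      refine L2NormLe.sum _ fun l hl => hA.l2NormLe_eigProj (hV _ ⟨by positivity, ?_⟩)
      have : (l : ℝ) ≤ N := by exact_mod_cast (Finset.mem_range.1 hl).le
      rw [← hT']
      gcongr
    have h2 : L2NormLe (fun μ => ∑ l ∈ Finset.range (N * J), ∑ i,
        ‖eigProj A μ (f (0 + l * τ + lobattoIIIC3.c i * τ))‖)
        ((Finset.range (N * J)).card * ((Finset.univ : Finset (Fin 3)).card * V)) := by
      refine L2NormLe.sum _ fun l hl => L2NormLe.sum _ fun i _ => hA.l2NormLe_eigProj (hV _ ?_)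
      have hl' : (l : ℝ) + 1 ≤ N * J := by exact_mod_cast Finset.mem_range.1 hl
      have hc : 0 ≤ lobattoIIIC3.c i ∧ lobattoIIIC3.c i ≤ 1 := by
        fin_cases i <;> norm_num [lobattoIIIC3]
      have hc0 := hc.1
      refine ⟨by positivity, ?_⟩
      calc 0 + l * τ + lobattoIIIC3.c i * τ = (l + lobattoIIIC3.c i) * τ := by ring
        _ ≤ (N * J) * τ := mul_le_mul_of_nonneg_right (by linarith [hc.2]) hτ0
        _ = T := by rw [mul_assoc, hT']
    convert (h0.add (h1.const_mul (mul_nonneg hJ0.le hτ0))).add (h0.add (h2.const_mul hτ0)) using 1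
    simp only [Finset.card_range, Finset.card_univ, Fintype.card_fin]
    push_cast
    linear_combination (-4 * V) * hT'
  have hbase : ∀ μ, 0 < μ → ∀ m ≤ N, ‖eigProj A μ (parareal A lobattoIIIC3 f u0 J τ 0 m
      - timeStepping A lobattoIIIC3 f u0 τ (m * J))‖ ≤ M μ := by
    intro μ hμ m hm
    rw [map_sub]
    refine (norm_sub_le _ _).trans (add_le_add ?_ ?_)
    · refine (hA.norm_eigProj_pararealInit_le f hτ0 u0 J hμ m).trans ?_
      gcongr
    · refine (hA.norm_eigProj_jSteps_le f hτ0 0 u0 hμ (m * J)).trans ?_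
      gcongr
  have hγ := hM.const_mul (show (0 : ℝ) ≤ (31 / 100) ^ k by positivity)
  refine hA.norm_le_of_sum_eigProj_le hγ.1 fun s => le_trans ?_ (hγ.2 s)
  refine Finset.sum_le_sum fun μ _ => ?_
  rcases le_or_gt μ 0 with hμ | hμ
  · rw [hA.eigProj_eq_zero hμ, norm_zero, zero_pow two_ne_zero]
    exact sq_nonneg _
  · exact pow_le_pow_left₀ (norm_nonneg _)
      (hA.norm_eigProj_parareal_sub_le f hτ0 u0 hJ hμ (hbase μ hμ) k n hn) 2

end Modes

end Parareal

end

theorem proposition4p3 {𝕜 : Type*} [RCLike 𝕜] {H : Type*} [NormedAddCommGroup H]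
    [InnerProductSpace 𝕜 H] [CompleteSpace H]
    (A : H →ₗ.[𝕜] H) (hA : Parareal.IsPosDefCompactInverse A)
    (T : ℝ) (hT : 0 < T) (u0 : H) (f : ℝ → H) (hf : ContinuousOn f (Set.Icc 0 T)) :
    (∀ s : ℝ, 0 ≤ s →
      Parareal.lobattoIIIC3.r (-s) = (24 - 6 * s) / (s ^ 3 + 6 * s ^ 2 + 18 * s + 24)) ∧
    ∃ c : ℝ, ∀ J Nc : ℕ, 2 ≤ J → 1 ≤ Nc → ∀ Δt : ℝ, Δt = T / (Nc * J) →
      ∀ k n : ℕ, 1 ≤ n → n ≤ Nc →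
        ‖Parareal.parareal A Parareal.lobattoIIIC3 f u0 J Δt k n
          - Parareal.timeStepping A Parareal.lobattoIIIC3 f u0 Δt (n * J)‖
          ≤ c * (0.31 : ℝ) ^ k := by
  refine ⟨fun s hs => Parareal.lobatto_r hs, ?_⟩
  obtain ⟨V, hV⟩ := isCompact_Icc.exists_bound_of_continuousOn hf
  refine ⟨2 * ‖u0‖ + 4 * T * V, fun J Nc hJ hN Δt hΔt k n _ hn => ?_⟩
  have h := Parareal.norm_parareal_sub_le hA hT u0 hV hJ hN hΔt k hn
  rw [mul_comm (_ ^ k)] at h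
  norm_num at h ⊢
  exact h
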